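/- Let $\mathbb{F}$ be a division ring, $n \in \mathbb{N}$, $\sigma : \mathbb{F} \to \mathbb{F}^{n\times n}$ a ring morphism and $\delta : \mathbb{F} \to \mathbb{F}^n$ a $\sigma$-derivation (additive, with $\delta(ab) = \sigma(a)\delta(b) + \delta(a)b$). Let $\mathbb{F}[\mathbf{x};\sigma,\delta]$ be the free multivariate skew polynomial ring: the left $\mathbb{F}$-vector space whose basis is the free monoid $\mathcal{M}$ on $x_1,\dots,x_n$, with product given by appending monomials and by $x_i c = \sum_{j} \sigma_{i,j}(c)x_j + \delta_i(c)$ for $c \in \mathbb{F}$. For $\mathbf{a} \in \mathbb{F}^n$ and $F \in \mathbb{F}[\mathbf{x};\sigma,\delta]$, let $F(\mathbf{a}) \in \mathbb{F}$ be the unique constant such that $F - F(\mathbf{a})$ lies in the left ideal $(x_1-a_1,\dots,x_n-a_n)$, and for $\Omega \subseteq \mathbb{F}^n$ let $I(\Omega)$ be the left ideal of all $F$ with $F(\mathbf{a}) = 0$ for every $\mathbf{a} \in \Omega$. For $\mathbf{a} \in \mathbb{F}^n$ put $\mathcal{D}_{\mathbf{a}}(\beta) = \sigma(\beta)\mathbf{a}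 + \delta(\beta) \in \mathbb{F}^n$ for $\beta \in \mathbb{F}$, and let $\mathcal{D}_{\mathbf{a}}^{\mathfrak{m}} : \mathbb{F} \to \mathbb{F}$, for $\mathfrak{m} \in \mathcal{M}$, be given by $\mathcal{D}_{\mathbf{a}}^{1} = \mathrm{Id}$ and $\mathcal{D}_{\mathbf{a}}^{x_i\mathfrak{m}} = (\mathcal{D}_{\mathbf{a}})_i \circ \mathcal{D}_{\mathbf{a}}^{\mathfrak{m}}$. Let $\mathbb{F}[\mathcal{D}_{\mathbf{a}}]$ be the ring (under composition) formed by the left $\mathbb{F}$-span of the operators $\mathcal{D}_{\mathbf{a}}^{\mathfrak{m}}$, and for $F = \sum_{\mathfrak{m}} F_{\mathfrak{m}}\mathfrak{m}$ write $F^{\mathcal{D}_{\mathbf{a}}} = \sum_{\mathfrak{m}} F_{\mathfrak{m}}\mathcal{D}_{\mathbf{a}}^{\mathfrak{m}}$. Let $K_{\mathbf{a}} = \{\beta \in \mathbb{F} : \mathcal{D}_{\mathbf{a}}(\beta) = \mathbf{a}\beta\}$, a division subring of $\mathbb{F}$, and let $\mathcal{C}(\mathbf{a}) = \{\mathcal{D}_{\mathbf{a}}(\beta)\beta^{-1}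 : \beta \in \mathbb{F}\setminus\{0\}\}$ be the conjugacy class of $\mathbf{a}$. If $\boldsymbol\beta = (\beta_1,\dots,\beta_M)$ is an ordered right basis of $\mathbb{F}$ over $K_{\mathbf{a}}$, let $\mu_{\boldsymbol\beta} : \mathbb{F}^M \to K_{\mathbf{a}}^{M\times M}$ be the bijection sending $(v_1,\dots,v_M)$ to the matrix $(v_j^i)_{i,j}$ with $v_j = \sum_i \beta_i v_j^i$, and put $\mathbf{v} \star_{\boldsymbol\beta} \mathbf{w} = \mu_{\boldsymbol\beta}^{-1}(\mu_{\boldsymbol\beta}(\mathbf{v})\mu_{\boldsymbol\beta}(\mathbf{w}))$. **Corollary.** Let $\mathbf{a}_1,\dots,\mathbf{a}_\ell \in \mathbb{F}^n$ be pairwise non-conjugate, suppose that $M_i = \dim^R_{K_{\mathbf{a}_i}}(\mathbb{F})$, the dimension of $\mathbb{F}$ as a right vector space over $K_{\mathbf{a}_i}$, is finite for $i = 1,\dots,\ell$, and let $\Omega = \mathcal{C}(\mathbf{a}_1)\cup\dots\cup\mathcal{C}(\mathbf{a}_\ell)$. The left ideals $I(\Omega)$ and $I(\mathcal{C}(\mathbf{a}_i))$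 are two-sided, and for all ordered right bases $\boldsymbol\beta_i = (\beta_{i,1},\dots,\beta_{i,M_i})$ of $\mathbb{F}$ over $K_{\mathbf{a}_i}$ there is a chain of ring isomorphisms $$ \mathbb{F}[\mathbf{x};\sigma,\delta]/I(\Omega) \cong \prod_{i=1}^\ell \mathbb{F}[\mathbf{x};\sigma,\delta]/I(\mathcal{C}(\mathbf{a}_i)) \cong \prod_{i=1}^\ell (\mathbb{F}[\mathcal{D}_{\mathbf{a}_i}],\circ) \cong \prod_{i=1}^\ell (\mathbb{F}^{M_i},\star_{\boldsymbol\beta_i}) \cong \prod_{i=1}^\ell K_{\mathbf{a}_i}^{M_i\times M_i}, $$ the first three of which are also left $\mathbb{F}$-linear. They are given, in this order, by $F + I(\Omega) \mapsto (F + I(\mathcal{C}(\mathbf{a}_i)))_i$, by $(F_i + I(\mathcal{C}(\mathbf{a}_i)))_i \mapsto (F_i^{\mathcal{D}_{\mathbf{a}_i}})_i$, by $(f_i)_i \mapsto (f_i(\beta_{i,1}),\dots,f_i(\beta_{i,M_i}))_i$, and by $(\mathbf{v}_i)_i \mapsto (\mu_{\boldsymbol\beta_i}(\mathbf{v}_i))_i$.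 In particular, the ring $\mathbb{F}[\mathbf{x};\sigma,\delta]/I(\Omega)$ is semisimple; that is, every left submodule of a left module over it is a direct summand. -/

import Mathlib

noncomputable section

universe u v

/-- A `σ`-derivation `δ : F → Fⁿ`, for a ring morphism `σ : F → F^{n × n}`: an additive map with
`δ(ab) = σ(a) δ(b) + δ(a) b`. -/
structure SigmaDerivation {F : Type u} [DivisionRing F] {n : ℕ}
    (σ : F →+* Matrix (Fin n) (Fin n) F) extends F →+ (Fin n → F) where
  leibniz' : ∀ a b : F, toFun (a * b) = (σ a).mulVec (toFun b) + fun i => toFun a i * b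

namespace SigmaDerivation

variable {F : Type u} [DivisionRing F] {n : ℕ} {σ : F →+* Matrix (Fin n) (Fin n) F}

instance : CoeFun (SigmaDerivation σ) (fun _ => F → Fin n → F) := ⟨fun δ => δ.toFun⟩

theorem map_add (δ : SigmaDerivation σ) (a b : F) : δ (a + b) = δ a + δ b := δ.map_add' a b

theorem map_zero (δ : SigmaDerivation σ) : δ 0 = 0 := δ.map_zero'

theorem map_mul (δ : SigmaDerivation σ) (a b : F) (i : Fin n) :
    δ (a * b) i = ∑ j, σ a i j * δ b j + δ a i * b := by
  have := congrFun (δ.leibniz' a b) i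
  simpa [Matrix.mulVec, dotProduct] using this

theorem map_one (δ : SigmaDerivation σ) : δ 1 = 0 := by
  funext i
  have h := δ.map_mul 1 1 i
  simpa [Matrix.one_apply] using h

/-! ### Families of operators obeying the commutation rule -/

section Ext

variable {V : Type v} [AddCommGroup V] [Module F V]

theorem end_add (f g : AddMonoid.End V) (v : V) : (f + g) v = f v + g v := rfl

theorem end_sub (f g : AddMonoid.End V) (v : V) : (f - g) v = f v - g v := rfl

theorem end_zero (v : V) : (0 : AddMonoid.End V) v = 0 := rfl

theorem end_one (v : V) : (1 : AddMonoid.End V) v = v := rfl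

theorem end_mul (f g : AddMonoid.End V) (v : V) : (f * g) v = f (g v) := rfl

theorem end_sum {ι : Type*} (s : Finset ι) (f : ι → AddMonoid.End V) (v : V) :
    (∑ i ∈ s, f i) v = ∑ i ∈ s, f i v := AddMonoidHom.finsetSum_apply f s v

/-- The operators `Y₁, …, Yₙ` satisfy `Yᵢ ∘ c = ∑ⱼ σᵢⱼ(c) Yⱼ + δᵢ(c)`. -/
def Rule (δ : SigmaDerivation σ) (Y : Fin n → AddMonoid.End V) : Prop :=
  ∀ (i : Fin n) (c : F) (v : V), Y i (c • v) = ∑ j, σ c i j • Y j v + δ c i • v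

/-- The additive map `∑ F_m m ↦ ∑ F_m Y^m`, where `Y^m` is the composition of the operators `Yᵢ`
along the monomial `m`. -/
def ext (Y : Fin n → AddMonoid.End V) : (FreeMonoid (Fin n) →₀ F) →ₗ[F] AddMonoid.End V :=
  Finsupp.linearCombination F (fun m => FreeMonoid.lift Y m)

theorem ext_single (Y : Fin n → AddMonoid.End V) (m : FreeMonoid (Fin n)) (c : F) (v : V) :
    ext Y (Finsupp.single m c) v = c • FreeMonoid.lift Y m v := by
  simp [ext]

end Ext

/-! ### The free multivariate skew polynomial ring -/

/-- The free skew polynomial ring `F[x; σ, δ]`: as a left vector space it has the free monoid on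
`n` letters as a basis. -/
def Poly (_δ : SigmaDerivation σ) : Type u := FreeMonoid (Fin n) →₀ F

variable (δ : SigmaDerivation σ)

instance : AddCommGroup δ.Poly := inferInstanceAs (AddCommGroup (FreeMonoid (Fin n) →₀ F))

instance : Module F δ.Poly := inferInstanceAs (Module F (FreeMonoid (Fin n) →₀ F))

/-- The term `c m`, for a constant `c` and a monomial `m`. -/
def term (m : FreeMonoid (Fin n)) (c : F) : δ.Poly := Finsupp.single m c

theorem term_add (m : FreeMonoid (Fin n)) (c d : F) :
    δ.term m (c + d) = δ.term m c + δ.term m d := Finsupp.single_add m c d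

theorem term_zero (m : FreeMonoid (Fin n)) : δ.term m 0 = 0 := Finsupp.single_zero m

theorem smul_term (b : F) (m : FreeMonoid (Fin n)) (c : F) :
    b • δ.term m c = δ.term m (b * c) := Finsupp.smul_single' b m c

theorem poly_induction {p : δ.Poly → Prop} (P : δ.Poly) (h0 : p 0)
    (hadd : ∀ P Q, p P → p Q → p (P + Q)) (ht : ∀ m c, p (δ.term m c)) : p P :=
  Finsupp.induction_linear P h0 hadd ht

/-- Left multiplication by the variable `xᵢ`:
`xᵢ (c m) = ∑ⱼ σᵢⱼ(c) xⱼ m + δᵢ(c) m`. -/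
def mulX (i : Fin n) : AddMonoid.End δ.Poly :=
  (Finsupp.liftAddHom (fun m : FreeMonoid (Fin n) =>
    ({ toFun := fun c => ∑ j, δ.term (FreeMonoid.of j * m) (σ c i j) + δ.term m (δ c i)
       map_zero' := by simp [term_zero, map_zero]
       map_add' := fun c d => by
        simp only [_root_.map_add, Matrix.add_apply, map_add, Pi.add_apply, term_add,
          Finset.sum_add_distrib]
        abel } : F →+ δ.Poly)) : (FreeMonoid (Fin n) →₀ F) →+ δ.Poly)

theorem mulX_term (i : Fin n) (m : FreeMonoid (Fin n)) (c : F) :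
    δ.mulX i (δ.term m c) =
      ∑ j, δ.term (FreeMonoid.of j * m) (σ c i j) + δ.term m (δ c i) :=
  Finsupp.liftAddHom_apply_single _ _ _

theorem mulX_rule : δ.Rule δ.mulX := by
  intro i c P
  induction P using poly_induction with
  | h0 => simp
  | hadd P Q hP hQ =>
    simp only [smul_add, _root_.map_add, hP, hQ, Finset.sum_add_distrib]
    abel
  | ht m d =>
    have hσ : ∀ k, δ.term (FreeMonoid.of k * m) (σ (c * d) i k)
        = ∑ j, δ.term (FreeMonoid.of k * m) (σ c i j * σ d j k) := by
      intro k
      rw [_root_.map_mul, Matrix.mul_apply]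
      exact _root_.map_sum (Finsupp.singleAddHom (FreeMonoid.of k * m)) _ _
    have hδ : δ.term m (δ (c * d) i)
        = ∑ j, δ.term m (σ c i j * δ d j) + δ.term m (δ c i * d) := by
      rw [map_mul, term_add]
      congr 1
      exact _root_.map_sum (Finsupp.singleAddHom m) _ _
    simp only [smul_term, mulX_term, smul_add, Finset.smul_sum, Finset.sum_add_distrib, hσ, hδ]
    rw [Finset.sum_comm]
    abel

instance : Mul δ.Poly := ⟨fun P Q => ext (F := F) δ.mulX P Q⟩

instance : One δ.Poly := ⟨δ.term 1 1⟩

theorem mul_def (P Q : δ.Poly) : P * Q = ext (F := F) δ.mulX P Q := rfl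

theorem one_def : (1 : δ.Poly) = δ.term 1 1 := rfl

section Ext

variable {V : Type v} [AddCommGroup V] [Module F V] {Y : Fin n → AddMonoid.End V}

/-- The additive map `ext Y`, on skew polynomials. -/
def extP (Y : Fin n → AddMonoid.End V) : δ.Poly →ₗ[F] AddMonoid.End V := ext Y

theorem mul_extP (P Q : δ.Poly) : P * Q = δ.extP δ.mulX P Q := rfl

theorem extP_term (m : FreeMonoid (Fin n)) (c : F) (v : V) :
    δ.extP Y (δ.term m c) v = c • FreeMonoid.lift Y m v := ext_single Y m c v

theorem extP_mulX (hY : δ.Rule Y) (i : Fin n) (Q : δ.Poly) (v : V) :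
    δ.extP Y (δ.mulX i Q) v = Y i (δ.extP Y Q v) := by
  induction Q using poly_induction with
  | h0 => simp
  | hadd P Q hP hQ => simp [end_add, hP, hQ]
  | ht m c =>
    rw [mulX_term, extP_term, hY i c]
    simp [extP_term, end_add, end_sum]

theorem extP_mul (hY : δ.Rule Y) (P Q : δ.Poly) (v : V) :
    δ.extP Y (P * Q) v = δ.extP Y P (δ.extP Y Q v) := by
  induction P using poly_induction with
  | h0 =>
    have : (0 : δ.Poly) * Q = 0 := by rw [mul_extP, _root_.map_zero, end_zero]
    rw [this]
    simp
  | hadd P P' hP hP' =>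
    have : (P + P') * Q = P * Q + P' * Q := by simp only [mul_extP, _root_.map_add, end_add]
    rw [this]
    simp [end_add, hP, hP']
  | ht m c =>
    have h1 : δ.term m c * Q = c • FreeMonoid.lift δ.mulX m Q := ext_single δ.mulX m c Q
    have h2 : ∀ R : δ.Poly, δ.extP Y (FreeMonoid.lift δ.mulX m R) v
        = FreeMonoid.lift Y m (δ.extP Y R v) := by
      intro R
      clear h1
      induction m using FreeMonoid.inductionOn' with
      | one => simp [end_one]
      | of_mul i m ih => simp [end_mul, extP_mulX δ hY, ih]
    rw [h1, extP_term, map_smul, ← h2]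
    rfl

end Ext

theorem lift_mulX_term (m m' : FreeMonoid (Fin n)) :
    FreeMonoid.lift δ.mulX m (δ.term m' 1) = δ.term (m * m') 1 := by
  induction m using FreeMonoid.inductionOn' with
  | one => simp
  | of_mul i m ih =>
    rw [_root_.map_mul, end_mul, ih, FreeMonoid.lift_eval_of, mulX_term]
    simp [Matrix.one_apply, map_one, term_zero, mul_assoc, apply_ite, Finset.sum_ite_eq]

/-- The ring `F[x; σ, δ]`. -/
instance : Ring δ.Poly where
  __ := (inferInstance : AddCommGroup δ.Poly)
  mul_assoc P Q R := by simpa only [mul_extP] using δ.extP_mul δ.mulX_rule P Q R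
  one_mul P := by
    rw [mul_extP, one_def, extP_term]; simp
  mul_one P := by
    induction P using poly_induction with
    | h0 => rw [mul_extP, _root_.map_zero, end_zero]
    | hadd P Q hP hQ => rw [mul_extP] at *; rw [_root_.map_add, end_add, hP, hQ]
    | ht m c =>
      rw [mul_extP, one_def, extP_term, lift_mulX_term, smul_term]; simp
  zero_mul P := by rw [mul_extP, _root_.map_zero, end_zero]
  mul_zero P := by rw [mul_extP, _root_.map_zero]
  left_distrib P Q R := by simp only [mul_extP, _root_.map_add]
  right_distrib P Q R := by simp only [mul_extP, _root_.map_add, end_add]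

instance : IsScalarTower F δ.Poly δ.Poly :=
  ⟨fun c P Q => by rw [smul_eq_mul, smul_eq_mul, mul_extP, map_smul]; rfl⟩

/-- The constants. -/
def C (c : F) : δ.Poly := δ.term 1 c

/-- The variables `xᵢ`. -/
def X (i : Fin n) : δ.Poly := δ.term (FreeMonoid.of i) 1

theorem C_mul (c : F) (P : δ.Poly) : δ.C c * P = c • P := by
  rw [mul_extP, C, extP_term]; simp

theorem C_one : δ.C 1 = 1 := rfl

theorem C_mul_C (c d : F) : δ.C (c * d) = δ.C c * δ.C d := by
  rw [C_mul, C, C, smul_term]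

/-- Products of monomials are given by appending. -/
theorem term_mul_term (m m' : FreeMonoid (Fin n)) :
    δ.term m 1 * δ.term m' 1 = δ.term (m * m') 1 := by
  rw [mul_extP, extP_term, lift_mulX_term, one_smul]

/-- The defining rule of the product. -/
theorem X_mul_C (i : Fin n) (c : F) :
    δ.X i * δ.C c = ∑ j, δ.C (σ c i j) * δ.X j + δ.C (δ c i) := by
  rw [mul_extP, X, extP_term, one_smul, FreeMonoid.lift_eval_of, C, mulX_term]
  simp only [C_mul, X, smul_term, mul_one]
  rfl

/-! ### The operators `D_a`, linearized polynomials, centralizers and conjugacy -/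

/-- The component `β ↦ (σ(β) a + δ(β))ᵢ` of the operator `D_a : F → Fⁿ`. -/
def D (a : Fin n → F) (i : Fin n) : AddMonoid.End F where
  toFun β := ((σ β).mulVec a + δ β) i
  map_zero' := by simp [map_zero]
  map_add' β γ := by
    simp only [_root_.map_add, Matrix.add_mulVec, map_add, Pi.add_apply]
    abel

theorem D_apply (a : Fin n → F) (i : Fin n) (β : F) :
    δ.D a i β = ∑ j, σ β i j * a j + δ β i := rfl

theorem D_mul (a : Fin n → F) (i : Fin n) (β γ : F) :
    δ.D a i (β * γ) = ∑ j, σ β i j * δ.D a j γ + δ β i * γ := by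
  simp only [D_apply, map_mul, _root_.map_mul, Matrix.mul_apply, mul_add, Finset.sum_add_distrib,
    Finset.mul_sum, Finset.sum_mul, mul_assoc]
  rw [Finset.sum_comm, add_assoc]

theorem D_one (a : Fin n → F) (i : Fin n) : δ.D a i 1 = a i := by
  simp [D_apply, Matrix.one_apply, map_one]

theorem D_rule (a : Fin n → F) : δ.Rule (δ.D a) := fun i c v => δ.D_mul a i c v

/-- The operator `D_a^m : F → F` of a monomial `m`, so that `D_a^{xᵢ m} = D_a^{xᵢ} ∘ D_a^m`. -/
def Dmon (a : Fin n → F) (m : FreeMonoid (Fin n)) : AddMonoid.End F :=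
  FreeMonoid.lift (δ.D a) m

/-- The ring morphism `φ_a : F ↦ F^{D_a} = ∑ F_m D_a^m`, into the additive operators of `F`
under composition. -/
def phi (a : Fin n → F) : δ.Poly →+* AddMonoid.End F where
  toFun P := Finsupp.linearCombination F (δ.Dmon a) P
  map_zero' := _root_.map_zero _
  map_add' P Q := _root_.map_add (Finsupp.linearCombination F (δ.Dmon a)) P Q
  map_one' := by
    refine AddMonoidHom.ext fun v => ?_
    exact (δ.extP_term (Y := δ.D a) 1 1 v).trans (by rw [one_smul, _root_.map_one]; rfl)
  map_mul' P Q := AddMonoidHom.ext fun v => δ.extP_mul (δ.D_rule a) P Q v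

theorem phi_term (a : Fin n → F) (m : FreeMonoid (Fin n)) (c β : F) :
    δ.phi a (δ.term m c) β = c * δ.Dmon a m β := δ.extP_term m c β

theorem phi_C (a : Fin n → F) (c β : F) : δ.phi a (δ.C c) β = c * β := by
  rw [C, phi_term]; simp [Dmon]

theorem phi_X (a : Fin n → F) (i : Fin n) (β : F) : δ.phi a (δ.X i) β = δ.D a i β := by
  rw [X, phi_term]; simp [Dmon]

theorem phi_smul (a : Fin n → F) (c : F) (P : δ.Poly) : δ.phi a (c • P) = c • δ.phi a P :=
  map_smul (Finsupp.linearCombination F (δ.Dmon a)) c P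

/-- The left vector space of linearized polynomials: the left span of the operators `D_a^m`. -/
def linSpan (a : Fin n → F) : Submodule F (AddMonoid.End F) :=
  Submodule.span F (Set.range (δ.Dmon a))

theorem mem_linSpan (a : Fin n → F) (f : AddMonoid.End F) :
    f ∈ δ.linSpan a ↔ ∃ P, δ.phi a P = f := by
  rw [linSpan, ← Finsupp.range_linearCombination]
  rfl

/-- The ring `F[D_a]` of linearized polynomials, with composition as product. -/
def LinPoly (a : Fin n → F) : Subring (AddMonoid.End F) where
  carrier := δ.linSpan a
  zero_mem' := (δ.linSpan a).zero_mem
  add_mem' := (δ.linSpan a).add_mem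
  neg_mem' := (δ.linSpan a).neg_mem
  one_mem' := (δ.mem_linSpan a _).2 ⟨1, _root_.map_one _⟩
  mul_mem' := by
    intro f g hf hg
    obtain ⟨P, rfl⟩ := (δ.mem_linSpan a _).1 hf
    obtain ⟨Q, rfl⟩ := (δ.mem_linSpan a _).1 hg
    exact (δ.mem_linSpan a _).2 ⟨P * Q, _root_.map_mul _ _ _⟩

instance (a : Fin n → F) : Module F (δ.LinPoly a) :=
  inferInstanceAs (Module F (δ.linSpan a))

/-- The centralizer `K_a = {β | D_a(β) = a β}`, a division subring of `F`. -/
def centralizer (a : Fin n → F) : Subfield F where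
  carrier := {β | ∀ i, δ.D a i β = a i * β}
  zero_mem' i := by simp
  one_mem' i := by simp [D_one]
  add_mem' {β γ} hβ hγ i := by simp [hβ i, hγ i, mul_add]
  neg_mem' {β} hβ i := by simp [hβ i]
  mul_mem' {β γ} hβ hγ i := by
    rw [D_mul]
    simp only [hγ _, ← mul_assoc, ← Finset.sum_mul, ← add_mul]
    rw [← D_apply, hβ i]
  inv_mem' β hβ i := by
    by_cases h : β = 0
    · simp [h]
    · have key : a i = δ.D a i β⁻¹ * β := by
        rw [← δ.D_one a i, ← inv_mul_cancel₀ h, D_mul]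
        simp only [hβ _, ← mul_assoc, ← Finset.sum_mul, ← add_mul]
        rw [← D_apply]
      rw [key, mul_assoc, mul_inv_cancel₀ h, mul_one]

/-- `F` as a right vector space over `K_a`: `β · λ = β λ`. -/
instance rightModule (a : Fin n → F) : Module (δ.centralizer a)ᵐᵒᵖ F where
  smul k β := β * (k.unop : F)
  one_smul β := mul_one β
  mul_smul k l β := (mul_assoc β (l.unop : F) (k.unop : F)).symm
  smul_zero _ := zero_mul _
  smul_add _ _ _ := add_mul _ _ _
  add_smul k l β := mul_add β (k.unop : F) (l.unop : F)
  zero_smul β := mul_zero β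

theorem op_smul_def (a : Fin n → F) (k : (δ.centralizer a)ᵐᵒᵖ) (β : F) :
    k • β = β * (k.unop : F) := rfl

/-- The conjugacy class `C(a) = {D_a(β) β⁻¹ | β ∈ F \ {0}}`. -/
def conjClass (a : Fin n → F) : Set (Fin n → F) :=
  {b | ∃ β : F, β ≠ 0 ∧ b = fun i => δ.D a i β * β⁻¹}

/-! ### Skew evaluation and vanishing ideals -/

/-- The left ideal `(x₁ - a₁, …, xₙ - aₙ)`. -/
def pointIdeal (a : Fin n → F) : Ideal δ.Poly :=
  Ideal.span (Set.range fun i => δ.X i - δ.C (a i))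

theorem phi_of_mem_pointIdeal (a b : Fin n → F) (β : F) (h : ∀ i, δ.D a i β = b i * β)
    {P : δ.Poly} (hP : P ∈ δ.pointIdeal b) : δ.phi a P β = 0 := by
  refine Submodule.span_induction (p := fun P _ => δ.phi a P β = 0) ?_ ?_ ?_ ?_ hP
  · rintro _ ⟨i, rfl⟩
    simp [end_sub, phi_X, phi_C, h i]
  · simp
  · intro P Q _ _ hP hQ
    simp [end_add, hP, hQ]
  · intro P Q _ hQ
    simp [smul_eq_mul, hQ]

theorem C_mem_pointIdeal (a : Fin n → F) {c : F} (h : δ.C c ∈ δ.pointIdeal a) : c = 0 := by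
  have := δ.phi_of_mem_pointIdeal a a 1 (fun i => by simp [D_one]) h
  simpa [phi_C] using this

theorem C_add (c d : F) : δ.C (c + d) = δ.C c + δ.C d := δ.term_add 1 c d

theorem C_sub (c d : F) : δ.C (c - d) = δ.C c - δ.C d := Finsupp.single_sub _ _ _

theorem C_sum (c : Fin n → F) : δ.C (∑ j, c j) = ∑ j, δ.C (c j) :=
  _root_.map_sum (Finsupp.singleAddHom (1 : FreeMonoid (Fin n))) c _

theorem exists_eval_term (a : Fin n → F) (m : FreeMonoid (Fin n)) :
    ∃ c, δ.term m 1 - δ.C c ∈ δ.pointIdeal a := by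
  induction m using FreeMonoid.inductionOn' with
  | one => exact ⟨1, by rw [C, sub_self]; exact Ideal.zero_mem _⟩
  | of_mul i m ih =>
    obtain ⟨c, hc⟩ := ih
    refine ⟨∑ j, σ c i j * a j + δ c i, ?_⟩
    have h2 : δ.term (FreeMonoid.of i * m) 1 = δ.X i * δ.term m 1 := (δ.term_mul_term _ _).symm
    have h3 : δ.term (FreeMonoid.of i * m) 1 - δ.C (∑ j, σ c i j * a j + δ c i)
        = δ.X i * (δ.term m 1 - δ.C c) + ∑ j, δ.C (σ c i j) * (δ.X j - δ.C (a j)) := by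
      rw [h2, mul_sub, X_mul_C, C_add, C_sum]
      simp only [mul_sub, Finset.sum_sub_distrib, C_mul_C]
      abel
    rw [h3]
    exact Ideal.add_mem _ (Ideal.mul_mem_left _ _ hc)
      (Ideal.sum_mem _ fun j _ => Ideal.mul_mem_left _ _ (Ideal.subset_span ⟨j, rfl⟩))

theorem existsUnique_eval (a : Fin n → F) (P : δ.Poly) :
    ∃! c : F, P - δ.C c ∈ δ.pointIdeal a := by
  refine existsUnique_of_exists_of_unique ?_ ?_
  · induction P using poly_induction with
    | h0 => exact ⟨0, by simp [C, term_zero]⟩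
    | hadd P Q hP hQ =>
      obtain ⟨c, hc⟩ := hP
      obtain ⟨d, hd⟩ := hQ
      exact ⟨c + d, by rw [C_add, add_sub_add_comm]; exact Ideal.add_mem _ hc hd⟩
    | ht m c =>
      obtain ⟨d, hd⟩ := δ.exists_eval_term a m
      refine ⟨c * d, ?_⟩
      have : δ.term m c - δ.C (c * d) = δ.C c * (δ.term m 1 - δ.C d) := by
        rw [mul_sub, C_mul, smul_term, mul_one, C_mul_C]
      rw [this]
      exact Ideal.mul_mem_left _ _ hd
  · intro c d hc hd
    have := Ideal.sub_mem _ hd hc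
    rw [sub_sub_sub_cancel_left, ← C_sub] at this
    exact sub_eq_zero.1 (δ.C_mem_pointIdeal a this)

/-- The skew evaluation `F(a)`: the unique constant with `F - F(a) ∈ (x₁ - a₁, …, xₙ - aₙ)`. -/
def eval (a : Fin n → F) (P : δ.Poly) : F := (δ.existsUnique_eval a P).choose

theorem eval_spec (a : Fin n → F) (P : δ.Poly) : P - δ.C (δ.eval a P) ∈ δ.pointIdeal a :=
  (δ.existsUnique_eval a P).choose_spec.1

theorem eval_eq_zero_iff (a : Fin n → F) (P : δ.Poly) :
    δ.eval a P = 0 ↔ P ∈ δ.pointIdeal a := by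
  constructor
  · intro h
    simpa [h, C, term_zero] using δ.eval_spec a P
  · intro h
    refine (δ.existsUnique_eval a P).unique (δ.eval_spec a P) ?_
    simpa [C, term_zero] using h

/-- The left ideal `I(Ω)` of the skew polynomials that vanish on `Ω`. -/
def vanishing (Ω : Set (Fin n → F)) : Ideal δ.Poly where
  carrier := {P | ∀ a ∈ Ω, δ.eval a P = 0}
  zero_mem' a _ := (δ.eval_eq_zero_iff a 0).2 (Ideal.zero_mem _)
  add_mem' hP hQ a ha := (δ.eval_eq_zero_iff a _).2
    (Ideal.add_mem _ ((δ.eval_eq_zero_iff a _).1 (hP a ha)) ((δ.eval_eq_zero_iff a _).1 (hQ a ha)))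
  smul_mem' R _ hP a ha := (δ.eval_eq_zero_iff a _).2
    (Ideal.mul_mem_left _ R ((δ.eval_eq_zero_iff a _).1 (hP a ha)))

theorem mem_vanishing_conjClass (a : Fin n → F) (P : δ.Poly) :
    P ∈ δ.vanishing (δ.conjClass a) ↔ δ.phi a P = 0 := by
  have key : ∀ β : F, β ≠ 0 →
      δ.phi a P β = δ.eval (fun i => δ.D a i β * β⁻¹) P * β := by
    intro β hβ
    have := δ.phi_of_mem_pointIdeal a (fun i => δ.D a i β * β⁻¹) β
      (fun i => by simp [mul_assoc, inv_mul_cancel₀ hβ]) (δ.eval_spec _ P)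
    rw [map_sub, end_sub, phi_C, sub_eq_zero] at this
    exact this
  constructor
  · intro h
    refine DFunLike.ext _ _ fun β => ?_
    by_cases hβ : β = 0
    · simp [hβ]
    · rw [key β hβ, h _ ⟨β, hβ, rfl⟩, zero_mul, end_zero]
  · rintro h _ ⟨β, hβ, rfl⟩
    have := key β hβ
    rw [h] at this
    exact (mul_eq_zero.1 this.symm).resolve_right hβ

instance (a : Fin n → F) : (δ.vanishing (δ.conjClass a)).IsTwoSided :=
  ⟨fun Q hP => by
    rw [mem_vanishing_conjClass] at *
    rw [_root_.map_mul, hP, zero_mul]⟩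

instance {ι : Type*} (a : ι → Fin n → F) :
    (δ.vanishing (⋃ i, δ.conjClass (a i))).IsTwoSided :=
  ⟨fun {P} Q hP b hb => by
    obtain ⟨i, hi⟩ := Set.mem_iUnion.1 hb
    have : P ∈ δ.vanishing (δ.conjClass (a i)) := fun c hc => hP c (Set.mem_iUnion.2 ⟨i, hc⟩)
    exact Ideal.mul_mem_right Q _ this b hi⟩

/-! ### The ring `F^M` with the matrix product of a right basis -/

section Star

variable {δ} {a : Fin n → F} {M : ℕ}

/-- The matrix-representation map `μ_β : F^M → K_a^{M × M}`: column `j` of `μ_β(x)` holds the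
right coordinates of `x_j` in the basis `β`, that is `x_j = ∑ᵢ βᵢ μ_β(x)ᵢⱼ`. -/
def mu (β : Module.Basis (Fin M) (δ.centralizer a)ᵐᵒᵖ F) :
    (Fin M → F) ≃+ Matrix (Fin M) (Fin M) (δ.centralizer a) where
  toFun x := Matrix.of fun i j => (β.repr (x j) i).unop
  invFun A j := ∑ i, β i * (A i j : F)
  left_inv x := funext fun j => β.sum_repr (x j)
  right_inv A := by
    ext i j
    have : ∑ i, β i * (A i j : F) = ∑ i, MulOpposite.op (A i j) • β i := rfl
    simp only [Matrix.of_apply, this, β.repr_sum_self, MulOpposite.unop_op]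
  map_add' x y := by
    ext i j
    simp

/-- The left vector space `F^M` with the matrix product `⋆` of the ordered right basis `β`. -/
def StarVec (_β : Module.Basis (Fin M) (δ.centralizer a)ᵐᵒᵖ F) : Type u := Fin M → F

variable (β : Module.Basis (Fin M) (δ.centralizer a)ᵐᵒᵖ F)

instance : AddCommGroup (StarVec β) := inferInstanceAs (AddCommGroup (Fin M → F))

instance : Module F (StarVec β) := inferInstanceAs (Module F (Fin M → F))

instance : Mul (StarVec β) := ⟨fun x y => (mu β).symm (mu β x * mu β y)⟩

instance : One (StarVec β) := ⟨(mu β).symm 1⟩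

/-- The map `μ_β`, on `(F^M, ⋆)`. -/
def muS : StarVec β ≃+ Matrix (Fin M) (Fin M) (δ.centralizer a) := mu β

theorem muS_mul (x y : StarVec β) : muS β (x * y) = muS β x * muS β y :=
  (mu β).apply_symm_apply _

theorem muS_one : muS β 1 = 1 := (mu β).apply_symm_apply _

instance : Ring (StarVec β) where
  __ := (inferInstance : AddCommGroup (StarVec β))
  mul_assoc x y z := (muS β).injective (by simp only [muS_mul, mul_assoc])
  one_mul x := (muS β).injective (by simp only [muS_mul, muS_one, one_mul])
  mul_one x := (muS β).injective (by simp only [muS_mul, muS_one, mul_one])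
  zero_mul x := (muS β).injective (by simp only [muS_mul, _root_.map_zero, zero_mul])
  mul_zero x := (muS β).injective (by simp only [muS_mul, _root_.map_zero, mul_zero])
  left_distrib x y z := (muS β).injective (by simp only [muS_mul, _root_.map_add, mul_add])
  right_distrib x y z := (muS β).injective (by simp only [muS_mul, _root_.map_add, add_mul])

end Star

end SigmaDerivation

end

noncomputable section

namespace SigmaDerivation

variable {F : Type*} [DivisionRing F] {n : ℕ} {σ : F →+* Matrix (Fin n) (Fin n) F}
  (δ : SigmaDerivation σ)

/-! Each point `a` makes `F` a simple left module over the skew polynomial ring, `P` acting as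
`P^{D_a}`. A homomorphism out of such a module is right multiplication by its value at `1`. Hence
the endomorphism ring at `a` consists of right multiplications by elements of `K_a`, and there are
no nonzero homomorphisms between non-conjugate points.

On a finite product of these modules, any family of right `K_{a_i}`-linear operators therefore
commutes with every module endomorphism (`pi_commute_end`). The Jacobson density theorem then yields
one polynomial with prescribed values on finite right bases at all points simultaneously
(`exists_phi_basis_eq`). This gives both surjectivity statements: `F[D_a]` takes all values on a
basis, and the Chinese remainder map is onto.

Injectivity comes from right linearity (`phi_ext_basis`) and from `P^{D_a}(β) = P(D_a(β)β⁻¹)β`, by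
which `I(C(a))` is the kernel of `P ↦ P^{D_a}`. Semisimplicity is inherited from matrix rings over
division rings. -/

/-! ### Right linearity over the centralizer -/

theorem D_mul_of_mem_centralizer (a : Fin n → F) (i : Fin n) (β : F) {k : F}
    (hk : k ∈ δ.centralizer a) : δ.D a i (β * k) = δ.D a i β * k := by
  have hk' : ∀ j, δ.D a j k = a j * k := hk
  rw [D_mul, D_apply, add_mul, Finset.sum_mul]
  simp only [hk', mul_assoc]

/-- Each component of `D_a` is right `K_a`-linear, and this property survives composition and left
linear combination. -/
theorem phi_mul_of_mem_centralizer (a : Fin n → F) (P : δ.Poly) (β : F) {k : F}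
    (hk : k ∈ δ.centralizer a) : δ.phi a P (β * k) = δ.phi a P β * k := by
  induction P using poly_induction with
  | h0 => simp
  | hadd P Q hP hQ => simp [end_add, hP, hQ, add_mul]
  | ht m c =>
    rw [phi_term, phi_term, mul_assoc]
    congr 1
    induction m using FreeMonoid.inductionOn' with
    | one => simp [Dmon, end_one]
    | of_mul i m ih =>
      simp only [Dmon, _root_.map_mul, end_mul, FreeMonoid.lift_eval_of] at ih ⊢
      rw [ih, D_mul_of_mem_centralizer δ a i _ hk]

/-- The operator `F^{D_a}`, as an endomorphism of the right vector space `F` over `K_a`. -/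
def phiLinear (a : Fin n → F) (P : δ.Poly) : F →ₗ[(δ.centralizer a)ᵐᵒᵖ] F where
  toFun := δ.phi a P
  map_add' := _root_.map_add _
  map_smul' k β := δ.phi_mul_of_mem_centralizer a P β k.unop.2

/-- Reduces congruence modulo `I(C(a))` to a comparison of values on a right basis. -/
theorem phi_ext_basis {a : Fin n → F} {ι : Type*}
    (β : Module.Basis ι (δ.centralizer a)ᵐᵒᵖ F) {P Q : δ.Poly}
    (h : ∀ j, δ.phi a P (β j) = δ.phi a Q (β j)) : δ.phi a P = δ.phi a Q := by
  have : δ.phiLinear a P = δ.phiLinear a Q := β.ext h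
  exact DFunLike.ext _ _ fun v => congrArg (fun f => f v) this

/-! ### Point modules and their homomorphisms -/

/-- The left `F[x; σ, δ]`-module `F[x; σ, δ] / (x₁ - a₁, …, xₙ - aₙ)`, realized on `F` by the
action `P • β = P^{D_a}(β)`. -/
def PointModule (_δ : SigmaDerivation σ) (_a : Fin n → F) : Type _ := F

namespace PointModule

variable (a b : Fin n → F)

instance : AddCommGroup (δ.PointModule a) := inferInstanceAs (AddCommGroup F)

instance : Nontrivial (δ.PointModule a) := inferInstanceAs (Nontrivial F)

instance : Module δ.Poly (δ.PointModule a) where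
  smul P β := δ.phi a P β
  one_smul β := by change δ.phi a 1 β = β; rw [_root_.map_one]; rfl
  mul_smul P Q β := by change δ.phi a (P * Q) β = _; rw [_root_.map_mul]; rfl
  smul_zero P := _root_.map_zero (δ.phi a P)
  smul_add P := _root_.map_add (δ.phi a P)
  add_smul P Q β := by change δ.phi a (P + Q) β = _; rw [_root_.map_add]; rfl
  zero_smul β := by change δ.phi a 0 β = _; rw [_root_.map_zero]; rfl

/-- The identity of `F`, with values in the point module. -/
def of : F ≃+ δ.PointModule a := AddEquiv.refl F

theorem smul_of (P : δ.Poly) (β : F) : P • of δ a β = of δ a (δ.phi a P β) := rfl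

theorem of_symm_smul (P : δ.Poly) (x : δ.PointModule a) :
    (of δ a).symm (P • x) = δ.phi a P ((of δ a).symm x) := rfl

/-- Constants act by left multiplication, so `y x⁻¹` already carries a nonzero `x` to any `y`. -/
instance : IsSimpleModule δ.Poly (δ.PointModule a) := by
  rw [isSimpleModule_iff_toSpanSingleton_surjective]
  refine ⟨inferInstance, fun x hx y =>
    ⟨δ.C ((of δ a).symm y * ((of δ a).symm x)⁻¹), (of δ a).symm.injective ?_⟩⟩
  have hx' : (of δ a).symm x ≠ 0 := hx
  rw [LinearMap.toSpanSingleton_apply, of_symm_smul, phi_C, mul_assoc, inv_mul_cancel₀ hx',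
    mul_one]

variable {δ a b} (g : δ.PointModule b →ₗ[δ.Poly] δ.PointModule a)

/-- Homomorphisms between point modules are right multiplications. -/
theorem hom_apply (β : F) :
    (of δ a).symm (g (of δ b β)) = β * (of δ a).symm (g (of δ b 1)) := by
  -- The element `β` is the constant `β` acting on `1`.
  have h := congrArg (of δ a).symm (g.map_smul (δ.C β) (of δ b 1))
  rwa [smul_of, of_symm_smul, phi_C, phi_C, mul_one] at h

/-- Compare the action of `x_k` before and after `g`: on `1` at the point `b` it gives `b_k`. For `b
= a` this places `g(1)` in `K_a`. -/
theorem D_hom_one (k : Fin n) :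
    δ.D a k ((of δ a).symm (g (of δ b 1))) = b k * (of δ a).symm (g (of δ b 1)) := by
  have h := congrArg (of δ a).symm (g.map_smul (δ.X k) (of δ b 1))
  rw [smul_of, of_symm_smul, phi_X, phi_X, D_one, hom_apply] at h
  exact h.symm

/-- A nonzero `g(1)` would be a conjugator, exhibiting `b` as `D_a(g(1)) g(1)⁻¹`. -/
theorem hom_one_eq_zero (hab : b ∉ δ.conjClass a) : (of δ a).symm (g (of δ b 1)) = 0 := by
  by_contra h
  refine hab ⟨_, h, funext fun k => ?_⟩
  rw [D_hom_one, mul_assoc, mul_inv_cancel₀ h, mul_one]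

end PointModule

/-! ### Interpolation by Jacobson density -/

section Density

variable {ι : Type*} [Finite ι] {a : ι → Fin n → F}

/-- A family of right linear operators commutes with the endomorphisms of a product of point
modules at pairwise non-conjugate points. -/
theorem pi_commute_end (hconj : Pairwise fun i j => a j ∉ δ.conjClass (a i))
    (A : ∀ i, F →ₗ[(δ.centralizer (a i))ᵐᵒᵖ] F)
    (g : Module.End δ.Poly (∀ i, δ.PointModule (a i))) (x : ∀ i, δ.PointModule (a i)) (i : ι) :
    A i ((PointModule.of δ (a i)).symm (g x i)) = (PointModule.of δ (a i)).symm
      (g (fun j => PointModule.of δ (a j) (A j ((PointModule.of δ (a j)).symm (x j)))) i) := by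
  classical
  cases nonempty_fintype ι
  -- Row `i` of the matrix of `g`; non-conjugacy kills its off-diagonal entries.
  let G : ∀ j, δ.PointModule (a j) →ₗ[δ.Poly] δ.PointModule (a i) := fun j =>
    LinearMap.proj i ∘ₗ g ∘ₗ LinearMap.single δ.Poly (fun j => δ.PointModule (a j)) j
  have hG : ∀ y : ∀ j, δ.PointModule (a j), (PointModule.of δ (a i)).symm (g y i) =
      (PointModule.of δ (a i)).symm (y i) *
        (PointModule.of δ (a i)).symm (G i (PointModule.of δ (a i) 1)) := by
    intro y
    have hy : g y i = ∑ j, G j (y j) := by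
      conv_lhs => rw [← LinearMap.sum_single_apply (φ := fun j => δ.PointModule (a j)) y]
      simp [G]
    rw [hy, _root_.map_sum, Finset.sum_eq_single i]
    · exact PointModule.hom_apply (G i) _
    · intro j _ hj
      refine (PointModule.hom_apply (G j) ((PointModule.of δ (a j)).symm (y j))).trans ?_
      rw [PointModule.hom_one_eq_zero _ (hconj hj.symm), mul_zero]
    · simp
  rw [hG, hG, AddEquiv.symm_apply_apply]
  -- The diagonal entry is right multiplication by an element of `K_{a_i}`, with which `A i`
  -- commutes.
  exact (A i).map_smul (MulOpposite.op ⟨_, PointModule.D_hom_one (G i)⟩) _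

/-- Simultaneous interpolation on right bases, for pairwise non-conjugate points. -/
theorem exists_phi_basis_eq (hconj : Pairwise fun i j => a j ∉ δ.conjClass (a i))
    {κ : ι → Type*} [∀ i, Finite (κ i)]
    (β : ∀ i, Module.Basis (κ i) (δ.centralizer (a i))ᵐᵒᵖ F) (v : ∀ i, κ i → F) :
    ∃ P : δ.Poly, ∀ i j, δ.phi (a i) P (β i j) = v i j := by
  classical
  cases nonempty_fintype ι
  have (i : ι) : Fintype (κ i) := Fintype.ofFinite _
  let A : ∀ i, F →ₗ[(δ.centralizer (a i))ᵐᵒᵖ] F := fun i => (β i).constr ℕ (v i)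
  -- The diagonal operator built from the `A i` lies in the bicommutant, so density applies to it.
  let f : Module.End (Module.End δ.Poly (∀ i, δ.PointModule (a i)))
      (∀ i, δ.PointModule (a i)) :=
    { toFun := fun x i =>
        PointModule.of δ (a i) (A i ((PointModule.of δ (a i)).symm (x i)))
      map_add' := fun x y => funext fun i => (A i).map_add (x i) (y i)
      map_smul' := fun g x => funext fun i => δ.pi_commute_end hconj A g x i }
  -- The test vectors are the basis elements, each supported in its own coordinate.
  obtain ⟨P, hP⟩ := jacobson_density f (Finset.univ.image fun p : Σ i, κ i =>
    (Pi.single p.1 (PointModule.of δ (a p.1) (β p.1 p.2)) : ∀ i, δ.PointModule (a i)))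
  refine ⟨P, fun i j => ?_⟩
  have h := congrArg (PointModule.of δ (a i)).symm
    (congrFun (hP _ (Finset.mem_image_of_mem _ (Finset.mem_univ ⟨i, j⟩))) i)
  rw [Pi.smul_apply, PointModule.of_symm_smul] at h
  simp only [f, LinearMap.coe_mk, AddHom.coe_mk, Pi.single_eq_same,
    AddEquiv.symm_apply_apply] at h
  rw [← h]
  exact (β i).constr_basis ℕ (v i) j

end Density

/-! ### The ring isomorphisms -/

section Equivalences

theorem mem_vanishing_iUnion {ι : Type*} (Ω : ι → Set (Fin n → F)) (P : δ.Poly) :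
    P ∈ δ.vanishing (⋃ i, Ω i) ↔ ∀ i, P ∈ δ.vanishing (Ω i) :=
  ⟨fun h i b hb => h b (Set.mem_iUnion.2 ⟨i, hb⟩), fun h b hb =>
    let ⟨i, hi⟩ := Set.mem_iUnion.1 hb
    h i b hi⟩

/-- The ring morphism `F ↦ F^{D_a}` onto the ring of linearized polynomials. -/
def toLinPoly (a : Fin n → F) : δ.Poly →+* δ.LinPoly a :=
  (δ.phi a).codRestrict (δ.LinPoly a) fun P => (δ.mem_linSpan a _).2 ⟨P, rfl⟩

/-- `F[x; σ, δ] / I(C(a)) ≅ F[D_a]`. -/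
def quotientEquivLinPoly (a : Fin n → F) :
    (δ.Poly ⧸ δ.vanishing (δ.conjClass a)) ≃+* δ.LinPoly a :=
  RingEquiv.ofBijective
    (Ideal.Quotient.lift _ (δ.toLinPoly a) fun P hP =>
      Subtype.ext ((δ.mem_vanishing_conjClass a P).1 hP)) <| by
    constructor
    · rw [injective_iff_map_eq_zero]
      intro x
      obtain ⟨P, rfl⟩ := Ideal.Quotient.mk_surjective x
      intro h
      rw [Ideal.Quotient.lift_mk] at h
      exact Ideal.Quotient.eq_zero_iff_mem.2
        ((δ.mem_vanishing_conjClass a P).2 (congrArg Subtype.val h))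
    · rintro ⟨f, hf⟩
      obtain ⟨P, rfl⟩ := (δ.mem_linSpan a f).1 hf
      exact ⟨Ideal.Quotient.mk _ P, rfl⟩

theorem quotientEquivLinPoly_smul (a : Fin n → F) (c : F)
    (x : δ.Poly ⧸ δ.vanishing (δ.conjClass a)) :
    δ.quotientEquivLinPoly a (c • x) = c • δ.quotientEquivLinPoly a x := by
  obtain ⟨P, rfl⟩ := Ideal.Quotient.mk_surjective x
  exact Subtype.ext (δ.phi_smul a c P)

section Star

variable {δ} {a : Fin n → F} {M : ℕ} (β : Module.Basis (Fin M) (δ.centralizer a)ᵐᵒᵖ F)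

theorem mu_symm_apply (A : Matrix (Fin M) (Fin M) (δ.centralizer a)) (j : Fin M) :
    (mu β).symm A j = ∑ i, β i * (A i j : F) := rfl

theorem sum_mul_mu (x : Fin M → F) (j : Fin M) : ∑ i, β i * (mu β x i j : F) = x j :=
  congrFun ((mu β).symm_apply_apply x) j

/-- Evaluation of linearized polynomials on a right basis is multiplicative for `⋆`. -/
def evalBasis : δ.LinPoly a →+* StarVec β where
  toFun f := fun j => (f : AddMonoid.End F) (β j)
  map_zero' := rfl
  map_add' _ _ := rfl
  map_one' := by
    change (fun j => β j) = (mu β).symm 1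
    funext j
    simp [mu_symm_apply, Matrix.one_apply, apply_ite]
  map_mul' f g := by
    obtain ⟨f, hf⟩ := f
    obtain ⟨P, rfl⟩ := (δ.mem_linSpan a f).1 hf
    obtain ⟨g, hg⟩ := g
    let x : Fin M → F := fun j => δ.phi a P (β j)
    let y : Fin M → F := fun j => g (β j)
    change (fun j => δ.phi a P (g (β j))) = (mu β).symm (mu β x * mu β y)
    funext j
    -- Expanding `g(β_j)` in the basis and using right linearity of `P^{D_a}` produces the matrix
    -- product.
    have hy : g (β j) = ∑ i, β i * (mu β y i j : F) := (sum_mul_mu β y j).symm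
    have hx : ∀ k, δ.phi a P (β k) = ∑ i, β i * (mu β x i k : F) :=
      fun k => (sum_mul_mu β x k).symm
    rw [hy, _root_.map_sum, mu_symm_apply]
    simp only [phi_mul_of_mem_centralizer δ a P _ (SetLike.coe_mem _), hx, Matrix.mul_apply,
      AddSubmonoidClass.coe_finsetSum, MulMemClass.coe_mul, Finset.mul_sum, Finset.sum_mul,
      mul_assoc]
    exact Finset.sum_comm

/-- Surjectivity is interpolation at a single point, where the non-conjugacy condition is vacuous.
-/
theorem evalBasis_bijective : Function.Bijective (evalBasis β) := by
  constructor
  · rintro ⟨f, hf⟩ ⟨g, hg⟩ h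
    obtain ⟨P, rfl⟩ := (δ.mem_linSpan a f).1 hf
    obtain ⟨Q, rfl⟩ := (δ.mem_linSpan a g).1 hg
    exact Subtype.ext (δ.phi_ext_basis β fun j => congrFun h j)
  · intro v
    obtain ⟨P, hP⟩ := δ.exists_phi_basis_eq (ι := Unit) (a := fun _ => a)
      (fun i j h => (h (Subsingleton.elim i j)).elim) (fun _ => β) (fun _ => v)
    exact ⟨δ.toLinPoly a P, funext (hP ())⟩

/-- `F[D_a] ≅ (F^M, ⋆)`, by evaluation on a right basis. -/
def linPolyEquivStarVec : δ.LinPoly a ≃+* StarVec β :=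
  RingEquiv.ofBijective (evalBasis β) (evalBasis_bijective β)

/-- `(F^M, ⋆) ≅ K_a^{M × M}`. -/
def starVecEquivMatrix : StarVec β ≃+* Matrix (Fin M) (Fin M) (δ.centralizer a) where
  __ := muS β
  map_mul' := muS_mul β
  map_add' := (muS β).map_add

end Star

section Chinese

variable {ι : Type*} {a : ι → Fin n → F}

/-- The canonical map `F[x; σ, δ] / I(⋃ᵢ C(aᵢ)) → ∏ᵢ F[x; σ, δ] / I(C(aᵢ))`. -/
def quotientToPi (a : ι → Fin n → F) :
    (δ.Poly ⧸ δ.vanishing (⋃ i, δ.conjClass (a i))) →+*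
      ∀ i, δ.Poly ⧸ δ.vanishing (δ.conjClass (a i)) :=
  Ideal.Quotient.lift _ (RingHom.pi fun i => Ideal.Quotient.mk (δ.vanishing (δ.conjClass (a i))))
    fun P hP => funext fun i =>
      Ideal.Quotient.eq_zero_iff_mem.2 ((δ.mem_vanishing_iUnion _ P).1 hP i)

/-- In place of comaximality of the ideals, surjectivity uses interpolation: one `P` matches the
operators of chosen representatives on a finite right basis at every point. -/
theorem quotientToPi_bijective [Finite ι]
    (hconj : Pairwise fun i j => a j ∉ δ.conjClass (a i))
    (hfin : ∀ i, Module.Finite (δ.centralizer (a i))ᵐᵒᵖ F) :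
    Function.Bijective (δ.quotientToPi a) := by
  constructor
  · rw [injective_iff_map_eq_zero]
    intro x h
    obtain ⟨P, rfl⟩ := Ideal.Quotient.mk_surjective x
    exact Ideal.Quotient.eq_zero_iff_mem.2 ((δ.mem_vanishing_iUnion _ P).2 fun i =>
      Ideal.Quotient.eq_zero_iff_mem.1 (congrFun h i))
  · intro y
    choose Q hQ using fun i => Ideal.Quotient.mk_surjective (y i)
    let β := fun i => Module.finBasis (δ.centralizer (a i))ᵐᵒᵖ F
    obtain ⟨P, hP⟩ := δ.exists_phi_basis_eq hconj β fun i j => δ.phi (a i) (Q i) (β i j)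
    refine ⟨Ideal.Quotient.mk _ P, funext fun i => Eq.trans ?_ (hQ i)⟩
    refine Ideal.Quotient.eq.2 ((δ.mem_vanishing_conjClass (a i) _).2 ?_)
    rw [map_sub, sub_eq_zero]
    exact δ.phi_ext_basis (β i) (hP i)

theorem quotientToPi_smul (c : F) (x : δ.Poly ⧸ δ.vanishing (⋃ i, δ.conjClass (a i))) :
    δ.quotientToPi a (c • x) = c • δ.quotientToPi a x := by
  obtain ⟨P, rfl⟩ := Ideal.Quotient.mk_surjective x
  rfl

end Chinese

end Equivalences

end SigmaDerivation

end

theorem mainTheorem7 {F : Type*} [DivisionRing F] {n : ℕ}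
    (σ : F →+* Matrix (Fin n) (Fin n) F) (δ : SigmaDerivation σ) {l : ℕ}
    (a : Fin l → Fin n → F)
    (hconj : Pairwise fun i j => a j ∉ δ.conjClass (a i))
    (hfin : ∀ i, Module.Finite (δ.centralizer (a i))ᵐᵒᵖ F) :
    (∀ β : ∀ i, Module.Basis (Fin (Module.finrank (δ.centralizer (a i))ᵐᵒᵖ F))
        (δ.centralizer (a i))ᵐᵒᵖ F,
      ∃ (e₁ : (δ.Poly ⧸ δ.vanishing (⋃ i, δ.conjClass (a i))) ≃+*
            ∀ i, δ.Poly ⧸ δ.vanishing (δ.conjClass (a i)))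
        (e₂ : (∀ i, δ.Poly ⧸ δ.vanishing (δ.conjClass (a i))) ≃+* ∀ i, δ.LinPoly (a i))
        (e₃ : (∀ i, δ.LinPoly (a i)) ≃+* ∀ i, SigmaDerivation.StarVec (β i))
        (e₄ : (∀ i, SigmaDerivation.StarVec (β i)) ≃+*
            ∀ i, Matrix (Fin (Module.finrank (δ.centralizer (a i))ᵐᵒᵖ F))
              (Fin (Module.finrank (δ.centralizer (a i))ᵐᵒᵖ F)) (δ.centralizer (a i))),
        (∀ (P : δ.Poly) (i : Fin l), e₁ (Ideal.Quotient.mk _ P) i = Ideal.Quotient.mk _ P) ∧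
        (∀ (c : F) x, e₁ (c • x) = c • e₁ x) ∧
        (∀ (P : Fin l → δ.Poly) (i : Fin l),
          (e₂ (fun k => Ideal.Quotient.mk _ (P k)) i : AddMonoid.End F) =
            δ.phi (a i) (P i)) ∧
        (∀ (c : F) x, e₂ (c • x) = c • e₂ x) ∧
        (∀ (f : ∀ i, δ.LinPoly (a i)) (i : Fin l),
          e₃ f i = fun j => (f i : AddMonoid.End F) (β i j)) ∧
        (∀ (c : F) x, e₃ (c • x) = c • e₃ x) ∧
        (∀ (v : ∀ i, SigmaDerivation.StarVec (β i)) (i : Fin l),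
          e₄ v i = SigmaDerivation.mu (β i) (v i))) ∧
    IsSemisimpleRing (δ.Poly ⧸ δ.vanishing (⋃ i, δ.conjClass (a i))) ∧
    ∀ (V : Type*) [AddCommGroup V]
      [Module (δ.Poly ⧸ δ.vanishing (⋃ i, δ.conjClass (a i))) V]
      (W : Submodule (δ.Poly ⧸ δ.vanishing (⋃ i, δ.conjClass (a i))) V),
      ∃ W' : Submodule (δ.Poly ⧸ δ.vanishing (⋃ i, δ.conjClass (a i))) V, IsCompl W W' := by
  refine ⟨fun β =>
    ⟨RingEquiv.ofBijective (δ.quotientToPi a) (δ.quotientToPi_bijective hconj hfin),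
      RingEquiv.piCongrRight fun i => δ.quotientEquivLinPoly (a i),
      RingEquiv.piCongrRight fun i => SigmaDerivation.linPolyEquivStarVec (β i),
      RingEquiv.piCongrRight fun i => SigmaDerivation.starVecEquivMatrix (β i),
      fun _ _ => rfl, δ.quotientToPi_smul, fun _ _ => rfl,
      fun c x => funext fun i => δ.quotientEquivLinPoly_smul (a i) c (x i),
      fun _ _ => rfl, fun _ _ => rfl, fun _ _ => rfl⟩, ?_⟩
  -- Any choice of bases identifies the quotient with a finite product of matrix rings over division
  -- rings, which is semisimple.
  let β := fun i => Module.finBasis (δ.centralizer (a i))ᵐᵒᵖ F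
  let e := (RingEquiv.ofBijective (δ.quotientToPi a) (δ.quotientToPi_bijective hconj hfin)).trans
    (RingEquiv.piCongrRight fun i => ((δ.quotientEquivLinPoly (a i)).trans
      (SigmaDerivation.linPolyEquivStarVec (β i))).trans
        (SigmaDerivation.starVecEquivMatrix (β i)))
  have hss : IsSemisimpleRing (δ.Poly ⧸ δ.vanishing (⋃ i, δ.conjClass (a i))) :=
    e.symm.isSemisimpleRing
  exact ⟨hss, fun V _ _ W => exists_isCompl W⟩
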